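/- Let $\mathcal A$ and $\mathcal B$ be abelian categories with enough projective objects, with full subcategories of projective objects $\mathcal P_{\mathcal A}$ and $\mathcal P_{\mathcal B}$. Regard objects of an abelian category as complexes concentrated in degree $0$, and regard $K^b(\mathcal P_{\mathcal A})$ as the full subcategory of $D^b(\mathcal A)$ of objects isomorphic to bounded complexes of projective objects. The stable category $\underline{\mathcal A}$ has the same objects as $\mathcal A$, and its morphisms are those of $\mathcal A$ modulo the morphisms that factor through projective objects. Let $F\colon D^b(\mathcal A)\to D^b(\mathcal B)$ be a triangle functor that is *non-negative*: for every $X\in\mathcal A$, $F(X)$ has no cohomology in negative degrees, and for every $P\in\mathcal P_{\mathcal A}$, $F(P)$ is isomorphic to a bounded complex of projective objects of $\mathcal B$ with zero terms in all negative degrees. For each $X\in\mathcal A$ fix a distinguished triangle $$U_X\longrightarrow F(X)\xrightarrow{\ \pi_X\ } M_X\longrightarrow U_X[1]$$ in $D^b(\mathcal B)$ with $M_X\in\mathcal B$ and $U_X$ isomorphic to a complex of projective objects of $\mathcal B$ concentrated in degrees $1,\dots,n_X$ for some $n_X>0$ (such triangles exist). The *stable functor* $\bar F\colon\underline{\mathcal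 A}\to\underline{\mathcal B}$ is defined by $\bar F(X)=M_X$, and $\bar F$ sends the class of $f\colon X\to Y$ to the class of any morphism $b\colon M_X\to M_Y$ with $b\circ\pi_X=\pi_Y\circ F(f)$. An object $X\in\mathcal A$ is *Gorenstein projective* if there is an exact complex $P^\bullet=(\cdots\to P^{-1}\to P^0\xrightarrow{d^0}P^1\to\cdots)$ of projective objects of $\mathcal A$ such that $\operatorname{Hom}_{\mathcal A}(P^\bullet,Q)$ is exact for every $Q\in\mathcal P_{\mathcal A}$ and $X\cong\operatorname{Im}d^0$; similarly for $\mathcal B$. Suppose that $F$ admits a right adjoint $G\colon D^b(\mathcal B)\to D^b(\mathcal A)$ with $G(Q)\in K^b(\mathcal P_{\mathcal A})$ for all $Q\in\mathcal P_{\mathcal B}$, and let $m$ be a non-negative integer. Then, for every choice of the triangles above: 1. If $X\in\mathcal A$ satisfies $\operatorname{Hom}_{D(\mathcal A)}(X,P[i])=0$ for all $P\in\mathcal P_{\mathcal A}$ and all integers $i>m$, then $\operatorname{Hom}_{D(\mathcal B)}(\bar F(X),Q[i])=0$ for all $Q\in\mathcal P_{\mathcal B}$ and all integers $i>m$. 2.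 If $X\in\mathcal A$ is Gorenstein projective, then $\bar F(X)$ is Gorenstein projective. -/

import Mathlib

open CategoryTheory CategoryTheory.Limits CategoryTheory.Pretriangulated

universe w w₁ w₂ v v₁ v₂ u u₁ u₂

namespace StableFun

section Basic

open ZeroObject

variable {A : Type u} [Category.{v} A] [Abelian A]

/-! ### The stable category -/

/-- Two parallel morphisms are identified in the stable category when their difference
factors through a projective object. -/
def stableRel (A : Type u) [Category.{v} A] [Abelian A] : HomRel A := fun X Y f g =>
  ∃ (P : A) (_ : Projective P) (a : X ⟶ P) (b : P ⟶ Y), f - g = a ≫ b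

instance : Congruence (stableRel A) where
  comp_left f g g' := by
    rintro ⟨P, hP, a, b, h⟩
    exact ⟨P, hP, f ≫ a, b, by rw [← Preadditive.comp_sub, h, Category.assoc]⟩
  comp_right k h := by
    obtain ⟨P, hP, a, b, h⟩ := h
    exact ⟨P, hP, a, b ≫ k, by rw [← Preadditive.sub_comp, h, Category.assoc]⟩
  equivalence :=
    { refl := fun f => ⟨0, inferInstance, 0, 0, by simp⟩
      symm := by
        rintro f g ⟨P, hP, a, b, h⟩
        exact ⟨P, hP, -a, b, by rw [Preadditive.neg_comp, ← h, neg_sub]⟩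
      trans := by
        rintro f g k ⟨P, hP, a, b, h⟩ ⟨P', hP', a', b', h'⟩
        exact ⟨P ⊞ P', inferInstance, biprod.lift a a', biprod.desc b b', by
          rw [biprod.lift_desc, ← h, ← h']; abel⟩ }

/-- The stable category `A / proj`: the objects are those of `A`, and morphisms are taken modulo
the morphisms which factor through projective objects. -/
abbrev StableCat (A : Type u) [Category.{v} A] [Abelian A] :=
  CategoryTheory.Quotient (stableRel A)

lemma stableRel_add ⦃X Y : A⦄ (f₁ f₂ g₁ g₂ : X ⟶ Y) (hf : stableRel A f₁ f₂)
    (hg : stableRel A g₁ g₂) : stableRel A (f₁ + g₁) (f₂ + g₂) := by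
  obtain ⟨P, hP, a, b, h⟩ := hf
  obtain ⟨P', hP', a', b', h'⟩ := hg
  exact ⟨P ⊞ P', inferInstance, biprod.lift a a', biprod.desc b b', by
    rw [biprod.lift_desc, ← h, ← h']; abel⟩

instance : Preadditive (StableCat A) := CategoryTheory.Quotient.preadditive (stableRel A) stableRel_add

/-! ### Gorenstein projective objects -/

/-- `X` is Gorenstein projective: there is an exact complex `K` of projective objects, indexed by
`ℤ`, such that `Hom(K, Q)` is exact for every projective object `Q`, and such that
`X ≅ Im (K⁰ ⟶ K¹)`. -/
def IsGorensteinProjective (X : A) : Prop :=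
  ∃ K : CochainComplex A ℤ,
    (∀ i : ℤ, Projective (K.X i)) ∧
    K.Acyclic ∧
    (∀ (Q : A), Projective Q → ∀ (i : ℤ) (f : K.X i ⟶ Q), K.d (i - 1) i ≫ f = 0 →
      ∃ g : K.X (i + 1) ⟶ Q, K.d i (i + 1) ≫ g = f) ∧
    Nonempty (X ≅ image (K.d 0 1))

/-! ### Facts on mapping cones -/

lemma isZero_mappingCone_X {K L : CochainComplex A ℤ} (φ : K ⟶ L) (i : ℤ)
    (h₁ : IsZero (K.X (i + 1))) (h₂ : IsZero (L.X i)) :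
    IsZero ((CochainComplex.mappingCone φ).X i) :=
  (CochainComplex.mappingCone.isZero_X_iff φ i).2 ⟨h₁, h₂⟩

lemma projective_mappingCone_X {K L : CochainComplex A ℤ} (φ : K ⟶ L) (i : ℤ)
    (h₁ : Projective (K.X (i + 1))) (h₂ : Projective (L.X i)) :
    Projective ((CochainComplex.mappingCone φ).X i) :=
  Projective.of_iso (HomologicalComplex.homotopyCofiber.XIsoBiprod φ i (i + 1) rfl).symm
    inferInstance

lemma isLE_mappingCone {K L : CochainComplex A ℤ} (φ : K ⟶ L) (n : ℤ)
    [K.IsStrictlyLE (n + 1)] [L.IsStrictlyLE (n + 1)] (hd : ∀ i j, K.d i j = 0)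
    [Epi (φ.f (n + 1))] : (CochainComplex.mappingCone φ).IsLE n := by
  rw [CochainComplex.isLE_iff]
  intro i hi
  by_cases hi' : i = n + 1
  · subst hi'
    have hz : IsZero (K.X (n + 1 + 1)) := K.isZero_of_isStrictlyLE (n + 1) _ (by lia)
    rw [HomologicalComplex.exactAt_iff' _ n (n + 1) (n + 1 + 1) (by simp) (by simp),
      ShortComplex.exact_iff_epi _ ((isZero_mappingCone_X φ _
        (K.isZero_of_isStrictlyLE (n + 1) _ (by lia))
        (L.isZero_of_isStrictlyLE (n + 1) _ (by lia))).eq_of_tgt _ _)]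
    change Epi ((CochainComplex.mappingCone φ).d n (n + 1))
    have h₁ : (CochainComplex.mappingCone.inl φ).v (n + 1) n (by lia) ≫
        (CochainComplex.mappingCone φ).d n (n + 1) =
          φ.f (n + 1) ≫ (CochainComplex.mappingCone.inr φ).f (n + 1) := by
      rw [CochainComplex.mappingCone.inl_v_d φ (n + 1) n (n + 1 + 1) (by lia) (by lia), hd,
        zero_comp, sub_zero]
    have h₂ := CochainComplex.mappingCone.id_X φ (n + 1) (n + 1 + 1) rfl
    rw [hz.eq_of_tgt ((CochainComplex.mappingCone.fst φ).1.v (n + 1) (n + 1 + 1) rfl) 0,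
      zero_comp, zero_add] at h₂
    have : Epi ((CochainComplex.mappingCone.inr φ).f (n + 1)) :=
      epi_of_epi_fac h₂
    exact epi_of_epi_fac h₁
  · exact ShortComplex.exact_of_isZero_X₂ _ (isZero_mappingCone_X φ _
        (K.isZero_of_isStrictlyLE (n + 1) _ (by lia))
        (L.isZero_of_isStrictlyLE (n + 1) _ (by lia)))

variable [HasDerivedCategory.{w} A]

/-! ### Subcategories of the derived category -/

/-- `𝒫[a, b]`: the objects of the derived category isomorphic to a complex of projective objects
whose terms vanish outside of the degrees `a, ..., b`. -/
def projInterval (A : Type u) [Category.{v} A] [Abelian A] [HasDerivedCategory.{w} A]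
    (a b : ℤ) : ObjectProperty (DerivedCategory A) := fun X =>
  ∃ K : CochainComplex A ℤ, K.IsStrictlyGE a ∧ K.IsStrictlyLE b ∧
    (∀ i : ℤ, Projective (K.X i)) ∧ Nonempty (X ≅ DerivedCategory.Q.obj K)

/-- `K^b(proj)`, as a full subcategory of the derived category: the objects isomorphic to
a bounded complex of projective objects. -/
def boundedProj (A : Type u) [Category.{v} A] [Abelian A] [HasDerivedCategory.{w} A] :
    ObjectProperty (DerivedCategory A) := fun X => ∃ a b : ℤ, projInterval A a b X

/-- The objects of the derived category which are projective objects of `A`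
(placed in degree `0`). -/
def projSingle (A : Type u) [Category.{v} A] [Abelian A] [HasDerivedCategory.{w} A] :
    ObjectProperty (DerivedCategory A) := fun Y =>
  ∃ P : A, Projective P ∧ Y = (DerivedCategory.singleFunctor A 0).obj P

/-- The left orthogonal `^{⊥ > n} 𝒳`: the objects `Z` such that `Hom(Z, X[i]) = 0` for all
`X` in `𝒳` and all integers `i > n`. -/
def leftPerpGT (n : ℤ) (𝒳 : ObjectProperty (DerivedCategory A)) :
    ObjectProperty (DerivedCategory A) := fun Z =>
  ∀ X, 𝒳 X → ∀ i : ℤ, n < i → ∀ f : Z ⟶ X⟦i⟧, f = 0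

/-- The embedding of `A` in its bounded derived category `D^b(A)`, in degree `0`. -/
noncomputable def single (A : Type u) [Category.{v} A] [Abelian A] [HasDerivedCategory.{w} A] :
    A ⥤ DerivedCategory.Bounded A :=
  ObjectProperty.lift _ (DerivedCategory.singleFunctor A 0)
    (fun _ => ⟨⟨0, inferInstance⟩, ⟨0, inferInstance⟩⟩)

instance : (single A).Additive where
  map_add {X Y f g} := by
    apply (DerivedCategory.Bounded.ι (C := A)).map_injective
    exact (DerivedCategory.singleFunctor A 0).map_add

/-! ### Facts on complexes of projective objects -/

open DerivedCategory

instance (a b : ℤ) : (projInterval A a b).IsClosedUnderIsomorphisms where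
  of_iso e := by
    rintro ⟨K, h₁, h₂, h₃, ⟨e'⟩⟩
    exact ⟨K, h₁, h₂, h₃, ⟨e.symm ≪≫ e'⟩⟩

lemma projInterval_mono {a b b' : ℤ} (h : b ≤ b') : projInterval A a b ≤ projInterval A a b' := by
  rintro X ⟨K, h₁, h₂, h₃, e⟩
  exact ⟨K, h₁, K.isStrictlyLE_of_le b b' h, h₃, e⟩

lemma projInterval_shift {a b : ℤ} {X : DerivedCategory A} (hX : projInterval A a b X)
    (n a' b' : ℤ) (ha : n + a' = a) (hb : n + b' = b) : projInterval A a' b' (X⟦n⟧) := by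
  obtain ⟨K, h₁, h₂, h₃, ⟨e⟩⟩ := hX
  refine ⟨K⟦n⟧, K.isStrictlyGE_shift a n a' ha, K.isStrictlyLE_shift b n b' hb,
    fun i => h₃ (i + n), ⟨(shiftFunctor _ n).mapIso e ≪≫ (Q.commShiftIso n).symm.app K⟩⟩

/-- Morphisms in the derived category out of a bounded above complex of projective objects
are induced by morphisms of complexes. -/
lemma Q_map_surjective (K L : CochainComplex A ℤ) (b : ℤ) [K.IsStrictlyLE b]
    (hK : ∀ i : ℤ, Projective (K.X i)) (f : Q.obj K ⟶ Q.obj L) : ∃ g : K ⟶ L, Q.map g = f := by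
  have := CochainComplex.isKProjective_of_projective K b
  obtain ⟨g, hg⟩ := (CochainComplex.IsKProjective.Qh_map_bijective K
    ((HomotopyCategory.quotient _ _).obj L)).surjective
    ((quotientCompQhIso A).hom.app K ≫ f ≫ (quotientCompQhIso A).inv.app L)
  obtain ⟨g, rfl⟩ := (HomotopyCategory.quotient _ _).map_surjective g
  refine ⟨g, ?_⟩
  rw [← cancel_epi ((quotientCompQhIso A).hom.app K), ← quotientCompQhIso_hom_naturality, hg]
  simp

lemma hom_eq_zero {n : ℤ} {U : DerivedCategory A} (hU : projInterval A 1 n U) (M : A)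
    (f : U ⟶ (singleFunctor A 0).obj M) : f = 0 := by
  obtain ⟨K, h₁, h₂, h₃, ⟨e⟩⟩ := hU
  obtain ⟨g, hg⟩ := Q_map_surjective K ((CochainComplex.singleFunctor A 0).obj M) n h₃ (e.inv ≫ f)
  have : g = 0 := by
    apply HomologicalComplex.to_single_hom_ext
    exact (K.isZero_of_isStrictlyGE 1 0 (by simp)).eq_of_src _ _
  rw [this, Functor.map_zero] at hg
  rw [← cancel_epi e.inv, comp_zero]
  exact hg.symm

lemma exists_fac {n : ℤ} {V : DerivedCategory A} (hV : projInterval A 0 n V) {M M' : A}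
    (g : (singleFunctor A 0).obj M ⟶ V) (h : V ⟶ (singleFunctor A 0).obj M') :
    ∃ (P : A) (_ : Projective P) (a : M ⟶ P) (b : P ⟶ M'),
      g ≫ h = (singleFunctor A 0).map (a ≫ b) := by
  obtain ⟨K, h₁, h₂, h₃, ⟨e⟩⟩ := hV
  obtain ⟨η, hη⟩ := Q_map_surjective K ((CochainComplex.singleFunctor A 0).obj M') n h₃ (e.inv ≫ h)
  let p : K ⟶ (CochainComplex.singleFunctor A 0).obj (K.X 0) :=
    HomologicalComplex.mkHomToSingle (𝟙 _) (by
      intro i hi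
      have hi : i + 1 = 0 := hi
      exact (K.isZero_of_isStrictlyGE 0 i (by lia)).eq_of_src _ _)
  let b : K.X 0 ⟶ M' := η.f 0 ≫ (HomologicalComplex.singleObjXSelf (.up ℤ) 0 M').hom
  have hp : p ≫ (CochainComplex.singleFunctor A 0).map b = η := by
    apply HomologicalComplex.to_single_hom_ext
    simp [p, b, CochainComplex.singleFunctor, CochainComplex.singleFunctors,
      HomologicalComplex.single_map_f_self]
  let α : (singleFunctor A 0).obj M ⟶ (singleFunctor A 0).obj (K.X 0) := g ≫ e.hom ≫ Q.map p
  obtain ⟨a, ha⟩ := (singleFunctor A 0).map_surjective α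
  refine ⟨K.X 0, h₃ 0, a, b, ?_⟩
  have : Q.map p ≫ (singleFunctor A 0).map b = Q.map η := by
    rw [← hp, Functor.map_comp]
    rfl
  calc g ≫ h = g ≫ e.hom ≫ (e.inv ≫ h) := by rw [Iso.hom_inv_id_assoc]
    _ = g ≫ e.hom ≫ (Q.map p ≫ (singleFunctor A 0).map b) :=
      congr_arg (fun z => g ≫ e.hom ≫ z) (hη.symm.trans this.symm)
    _ = (g ≫ e.hom ≫ Q.map p) ≫ (singleFunctor A 0).map b :=
      (congr_arg (fun z => g ≫ z) (Category.assoc _ _ _).symm).trans (Category.assoc _ _ _).symm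
    _ = α ≫ (singleFunctor A 0).map b := rfl
    _ = _ := by rw [Functor.map_comp, ha]

/-- The class `𝒫[a, b]` is closed under extensions. -/
lemma projInterval_ext (a b : ℤ) :
    (projInterval A a b).extensionProduct (projInterval A a b) ≤ projInterval A a b := by
  rintro U ⟨X, Z, f, g, h, hT, ⟨K, hK₁, hK₂, hK₃, ⟨e⟩⟩, ⟨L, hL₁, hL₂, hL₃, ⟨e'⟩⟩⟩
  obtain ⟨ψ, hψ⟩ := Q_map_surjective L (K⟦(1 : ℤ)⟧) b hL₃
    (e'.inv ≫ h ≫ e.hom⟦(1 : ℤ)⟧' ≫ (Q.commShiftIso (1 : ℤ)).inv.app K)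
  have hK₁' := K.isStrictlyGE_shift a 1 (a - 1) (by lia)
  have hK₂' := K.isStrictlyLE_shift b 1 (b - 1) (by lia)
  have iso := isoTriangleOfIso₁₂ _ _ (rot_of_distTriang _ (rot_of_distTriang _ hT))
    (mappingCone_triangle_distinguished ψ) e'
    ((shiftFunctor (DerivedCategory A) (1 : ℤ)).mapIso e ≪≫ (Q.commShiftIso (1 : ℤ)).symm.app K) (by
      change h ≫ (e.hom⟦(1 : ℤ)⟧' ≫ (Q.commShiftIso (1 : ℤ)).inv.app K) = e'.hom ≫ Q.map ψ
      rw [hψ, Iso.hom_inv_id_assoc])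
  have hU : projInterval A (a - 1) (b - 1) (U⟦(1 : ℤ)⟧) := by
    refine ⟨CochainComplex.mappingCone ψ, ?_, ?_, ?_, ⟨Triangle.π₃.mapIso iso⟩⟩
    · rw [CochainComplex.isStrictlyGE_iff]
      intro i hi
      exact isZero_mappingCone_X _ _ (L.isZero_of_isStrictlyGE a _ (by lia))
        (CochainComplex.isZero_of_isStrictlyGE _ (a - 1) _ (by lia))
    · rw [CochainComplex.isStrictlyLE_iff]
      intro i hi
      exact isZero_mappingCone_X _ _ (L.isZero_of_isStrictlyLE b _ (by lia))
        (CochainComplex.isZero_of_isStrictlyLE _ (b - 1) _ (by lia))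
    · intro i
      exact projective_mappingCone_X _ _ (hL₃ _) (hK₃ _)
  exact (projInterval A a b).prop_of_iso ((shiftFunctorCompIsoId _ (1 : ℤ) (-1) (by simp)).app U)
    (projInterval_shift hU (-1) a b (by lia) (by lia))

/-- The objects of `A`, placed in degree `0`, up to isomorphism. -/
def singleEssImage (A : Type u) [Category.{v} A] [Abelian A] [HasDerivedCategory.{w} A] :
    ObjectProperty (DerivedCategory A) := fun Y =>
  ∃ M : A, Nonempty (Y ≅ (singleFunctor A 0).obj M)

lemma exists_triangle [EnoughProjectives A] (n : ℕ) (Y : DerivedCategory A) (h₀ : Y.IsGE 0)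
    (h₁ : Y.IsLE n) : (projInterval A 1 n).extensionProduct (singleEssImage A) Y := by
  induction n generalizing Y with
  | zero =>
    obtain ⟨M, ⟨e⟩⟩ := exists_iso_singleFunctor_obj_of_isGE_of_isLE Y 0
    have : (projInterval A 1 (0 : ℕ)).ContainsZero := by
      refine ⟨⟨0, isZero_zero _, ?_⟩⟩
      refine ⟨0, ?_, ?_, fun i => ?_, ⟨(Functor.mapZeroObject Q).symm⟩⟩
      · rw [CochainComplex.isStrictlyGE_iff]
        exact fun i _ => (HomologicalComplex.eval _ _ i).map_isZero (isZero_zero _)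
      · rw [CochainComplex.isStrictlyLE_iff]
        exact fun i _ => (HomologicalComplex.eval _ _ i).map_isZero (isZero_zero _)
      · exact Projective.of_iso
          ((HomologicalComplex.eval _ _ i).map_isZero (isZero_zero _)).isoZero.symm inferInstance
    exact ObjectProperty.le_extensionProduct_right _ _ ⟨M, ⟨e⟩⟩
  | succ n ih =>
    obtain ⟨K, hK₀, hK₁, ⟨e⟩⟩ := exists_iso_Q_obj_of_isGE_of_isLE Y 0 ((n + 1 : ℕ) : ℤ)
    push_cast at hK₁
    let S := (CochainComplex.singleFunctor A ((n : ℤ) + 1)).obj (Projective.over (K.X (n + 1)))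
    let φ : S ⟶ K := HomologicalComplex.mkHomFromSingle (Projective.π (K.X (n + 1))) (by
      intro i hi
      have hi : (n : ℤ) + 1 + 1 = i := hi
      exact (K.isZero_of_isStrictlyLE (n + 1) i (by lia)).eq_of_tgt _ _)
    have : Epi (φ.f (n + 1)) := by
      rw [HomologicalComplex.mkHomFromSingle_f]
      exact epi_comp' (@IsIso.epi_of_iso _ _ _ _ _ (Iso.isIso_hom
        (HomologicalComplex.singleObjXSelf (.up ℤ) ((n : ℤ) + 1) (Projective.over _)))) inferInstance
    have hS₁ : S.IsStrictlyLE (n + 1) := by dsimp [S]; infer_instance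
    have hS₀ : S.IsStrictlyGE (n + 1) := by dsimp [S]; infer_instance
    have hLE := isLE_mappingCone φ n (fun _ _ => rfl)
    have hGE : (CochainComplex.mappingCone φ).IsStrictlyGE 0 := by
      rw [CochainComplex.isStrictlyGE_iff]
      intro i hi
      exact isZero_mappingCone_X φ _ (S.isZero_of_isStrictlyGE (n + 1) _ (by lia))
        (K.isZero_of_isStrictlyGE 0 _ (by lia))
    have hS : projInterval A 1 ((n + 1 : ℕ) : ℤ) (Q.obj S) := by
      refine ⟨S, CochainComplex.isStrictlyGE_of_ge S 1 (n + 1) (by lia), by push_cast; exact hS₁,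
        fun i => ?_, ⟨Iso.refl _⟩⟩
      by_cases hi : i = n + 1
      · subst hi
        exact Projective.of_iso (HomologicalComplex.singleObjXSelf (.up ℤ) _ _).symm inferInstance
      · exact Projective.of_iso
          (HomologicalComplex.isZero_single_obj_X (.up ℤ) _ _ _ hi).isoZero.symm inferInstance
    have := ih (Q.obj (CochainComplex.mappingCone φ)) inferInstance inferInstance
    have := ObjectProperty.monotone_extensionProduct_left (singleEssImage A)
      (projInterval_mono (A := A) (a := 1) (b := n) (b' := ((n + 1 : ℕ) : ℤ)) (by simp)) _ this
    have : (projInterval A 1 ((n + 1 : ℕ) : ℤ)).extensionProduct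
        ((projInterval A 1 ((n + 1 : ℕ) : ℤ)).extensionProduct (singleEssImage A)) (Q.obj K) :=
      ⟨_, _, _, _, _, mappingCone_triangle_distinguished φ, hS, this⟩
    rw [← ObjectProperty.extensionProduct_assoc] at this
    exact ObjectProperty.prop_of_iso _ e.symm
      (ObjectProperty.monotone_extensionProduct_left _ (projInterval_ext _ _) _ this)

end Basic

section Functors

variable {A : Type u₁} [Category.{v₁} A] [Abelian A] [HasDerivedCategory.{w₁} A]
  {B : Type u₂} [Category.{v₂} B] [Abelian B] [HasDerivedCategory.{w₂} B]

/-- A functor `F : D^b(A) ⥤ D^b(B)` is non-negative if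
(1) for every `X` in `A`, `F(X)` has no cohomology in negative degrees, and
(2) for every projective object `P` of `A`, `F(P)` is isomorphic to a bounded complex of projective
objects with zero terms in all negative degrees. -/
structure IsNonnegative (F : DerivedCategory.Bounded A ⥤ DerivedCategory.Bounded B) : Prop where
  isGE (X : A) : (F.obj ((single A).obj X)).obj.IsGE 0
  proj (P : A) (hP : Projective P) :
    ∃ n : ℤ, projInterval B 0 n (F.obj ((single A).obj P)).obj

/-- The choices that define the stable functor of `F : D^b(A) ⥤ D^b(B)`: for every object `X` of
`A`, a distinguished triangle `U_X ⟶ F(X) ⟶ M_X ⟶ U_X[1]` in `D^b(B)` with `M_X` in `B` and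
`U_X` isomorphic to a complex of projective objects in degrees `1, ..., n_X`, for some
`n_X > 0`. -/
structure StableChoice (F : DerivedCategory.Bounded A ⥤ DerivedCategory.Bounded B) where
  /-- the complex `U_X` -/
  U : A → DerivedCategory.Bounded B
  /-- the object `M_X` -/
  M : A → B
  /-- the first morphism of the triangle -/
  ι (X : A) : U X ⟶ F.obj ((single A).obj X)
  /-- the second morphism of the triangle -/
  π (X : A) : F.obj ((single A).obj X) ⟶ (single B).obj (M X)
  /-- the third morphism of the triangle -/
  μ (X : A) : (single B).obj (M X) ⟶ (U X)⟦(1 : ℤ)⟧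
  distinguished (X : A) : Triangle.mk (ι X) (π X) (μ X) ∈ distTriang (DerivedCategory.Bounded B)
  U_mem (X : A) : ∃ n : ℤ, 0 < n ∧ projInterval B 1 n (U X).obj

variable {F : DerivedCategory.Bounded A ⥤ DerivedCategory.Bounded B}

/-- If `F` is non-negative (and `B` has enough projective objects), then triangles as in
`StableChoice F` exist. -/
lemma IsNonnegative.nonempty_stableChoice [EnoughProjectives B] (hF : IsNonnegative F) :
    Nonempty (StableChoice F) := by
  have key (X : A) : ∃ (U : DerivedCategory.Bounded B) (M : B)
      (i : U ⟶ F.obj ((single A).obj X)) (p : F.obj ((single A).obj X) ⟶ (single B).obj M)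
      (m : (single B).obj M ⟶ U⟦(1 : ℤ)⟧),
      (Triangle.mk i p m ∈ distTriang (DerivedCategory.Bounded B)) ∧
        ∃ n : ℤ, 0 < n ∧ projInterval B 1 n U.obj := by
    obtain ⟨n, hn⟩ := (F.obj ((single A).obj X)).property.2
    obtain ⟨U, Z, i, p, m, hT, ⟨n, hn, hU⟩, M, ⟨e⟩⟩ :
        ObjectProperty.extensionProduct (fun U => ∃ n : ℤ, 0 < n ∧ projInterval B 1 n U)
          (singleEssImage B)
          (F.obj ((single A).obj X)).obj := by
      refine ObjectProperty.monotone_extensionProduct_left _ ?_ _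
        (exists_triangle (n.toNat + 1) _ (hF.isGE X)
          (DerivedCategory.TStructure.t.isLE_of_le _ n _ (by lia)))
      exact fun U hU => ⟨_, by simp, hU⟩
    let p' : F.obj ((single A).obj X) ⟶ (single B).obj M :=
      ObjectProperty.homMk (p ≫ e.hom)
    obtain ⟨U', i', m', hT'⟩ := distinguished_cocone_triangle₁ p'
    refine ⟨U', M, i', p', m', hT', n, hn, ?_⟩
    have hT'' := (DerivedCategory.Bounded.ι (C := B)).map_distinguished _ hT'
    have iso := isoTriangleOfIso₁₂ _ _ (rot_of_distTriang _ hT) (rot_of_distTriang _ hT'')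
      (Iso.refl _) e (Category.id_comp _).symm
    exact (projInterval B 1 n).prop_of_iso
      ((shiftEquiv (DerivedCategory B) (1 : ℤ)).functor.preimageIso (Triangle.π₃.mapIso iso)) hU
  choose U M i p m hT hU using key
  exact ⟨⟨U, M, i, p, m, hT, hU⟩⟩

namespace StableChoice

variable (ξ : StableChoice F)

/-- Every `f : X ⟶ Y` induces some `b : M_X ⟶ M_Y` compatible with `F(f)`. -/
lemma exists_map {X Y : A} (f : X ⟶ Y) : ∃ b : ξ.M X ⟶ ξ.M Y,
    ξ.π X ≫ (single B).map b = F.map ((single A).map f) ≫ ξ.π Y := by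
  obtain ⟨n, -, hn⟩ := ξ.U_mem X
  have h : ξ.ι X ≫ F.map ((single A).map f) ≫ ξ.π Y = 0 := by
    apply (DerivedCategory.Bounded.ι (C := B)).map_injective
    rw [Functor.map_zero]
    exact hom_eq_zero hn _ _
  obtain ⟨b, hb⟩ := Triangle.yoneda_exact₂ _ (ξ.distinguished X) _ h
  let b' : (DerivedCategory.singleFunctor B 0).obj (ξ.M X) ⟶
    (DerivedCategory.singleFunctor B 0).obj (ξ.M Y) := b.hom
  obtain ⟨c, hc⟩ := (DerivedCategory.singleFunctor B 0).map_surjective b'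
  refine ⟨c, ?_⟩
  have : (single B).map c = b := by
    apply (DerivedCategory.Bounded.ι (C := B)).map_injective
    exact hc
  rw [this]
  exact hb.symm

/-- The morphism `b` is unique modulo the morphisms which factor through projective objects. -/
lemma stableRel_of_eq {X : A} {N : B} {b b' : ξ.M X ⟶ N}
    (h : ξ.π X ≫ (single B).map b = ξ.π X ≫ (single B).map b') : stableRel B b b' := by
  obtain ⟨n, -, hn⟩ := ξ.U_mem X
  have h₀ : ξ.π X ≫ ((single B).map b - (single B).map b') = 0 := by
    rw [Preadditive.comp_sub, h, sub_self]
  obtain ⟨k, hk⟩ := Triangle.yoneda_exact₃ _ (ξ.distinguished X) _ h₀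
  have hU : projInterval B 0 (n - 1) ((ξ.U X)⟦(1 : ℤ)⟧).obj :=
    (projInterval B 0 (n - 1)).prop_of_iso
      (((DerivedCategory.Bounded.ι (C := B)).commShiftIso (1 : ℤ)).symm.app (ξ.U X))
      (projInterval_shift hn 1 0 (n - 1) (by lia) (by lia))
  obtain ⟨P, hP, r, s, hrs⟩ := exists_fac hU (ξ.μ X).hom k.hom
  refine ⟨P, hP, r, s, (DerivedCategory.singleFunctor B 0).map_injective ?_⟩
  rw [← hrs, Functor.map_sub]
  exact congr_arg (fun (z : (single B).obj (ξ.M X) ⟶ (single B).obj N) => z.hom) hk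

/-- The morphism `b_f : M_X ⟶ M_Y` attached to `f : X ⟶ Y`. -/
noncomputable def map {X Y : A} (f : X ⟶ Y) : ξ.M X ⟶ ξ.M Y := (ξ.exists_map f).choose

lemma π_map {X Y : A} (f : X ⟶ Y) :
    ξ.π X ≫ (single B).map (ξ.map f) = F.map ((single A).map f) ≫ ξ.π Y :=
  (ξ.exists_map f).choose_spec

/-- The functor `A ⥤ StableCat B`, `X ↦ M_X`, `f ↦ [b_f]`. -/
noncomputable def preStableFunctor : A ⥤ StableCat B where
  obj X := (Quotient.functor _).obj (ξ.M X)
  map f := (Quotient.functor _).map (ξ.map f)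
  map_id X := by
    rw [← CategoryTheory.Functor.map_id]
    exact CategoryTheory.Quotient.sound _ (ξ.stableRel_of_eq (by rw [π_map]; simp))
  map_comp f g := by
    rw [← Functor.map_comp]
    refine CategoryTheory.Quotient.sound _ (ξ.stableRel_of_eq ?_)
    rw [π_map, Functor.map_comp (single B), ← Category.assoc, π_map, Category.assoc, π_map]
    simp

/-- If `F` is non-negative, then `M_P` is projective for every projective object `P`. -/
lemma projective_M (hF : IsNonnegative F) (P : A) (hP : Projective P) :
    Projective (ξ.M P) := by
  obtain ⟨m, hm⟩ := hF.proj P hP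
  obtain ⟨n, -, hn⟩ := ξ.U_mem P
  have hT := (DerivedCategory.Bounded.ι (C := B)).map_distinguished _ (ξ.distinguished P)
  have h : projInterval B 0 (max m n) ((DerivedCategory.singleFunctor B 0).obj (ξ.M P)) := by
    refine projInterval_ext 0 (max m n) _ ⟨_, _, _, _, _, rot_of_distTriang _ hT,
      projInterval_mono (le_max_left m n) _ hm, ?_⟩
    exact projInterval_mono (by lia) _ (projInterval_shift hn 1 0 (n - 1) (by lia) (by lia))
  obtain ⟨R, hR, a, b, hab⟩ := exists_fac h (𝟙 _) (𝟙 _)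
  have : a ≫ b = 𝟙 (ξ.M P) := by
    apply (DerivedCategory.singleFunctor B 0).map_injective
    rw [← hab]
    simp
  exact Retract.projective ⟨a, b, this⟩

/-- The stable functor `F̄ : StableCat A ⥤ StableCat B` of `F`, for a choice `ξ` of triangles:
`F̄(X) = M_X`, and `F̄` sends the class of `f` to the class of any `b` such that
`F(f)` followed by `π_Y` is `π_X` followed by `b`. -/
noncomputable def stableFunctor [F.Additive] (hF : IsNonnegative F) :
    StableCat A ⥤ StableCat B :=
  CategoryTheory.Quotient.lift _ ξ.preStableFunctor (by
    rintro X Y f g ⟨P, hP, a, b, h⟩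
    refine CategoryTheory.Quotient.sound _ ?_
    obtain rfl := sub_eq_iff_eq_add'.1 h
    have h₁ : stableRel B (ξ.map (g + a ≫ b)) (ξ.map g + ξ.map a ≫ ξ.map b) := by
      refine ξ.stableRel_of_eq ?_
      rw [π_map, Functor.map_add, Functor.map_add, Functor.map_add, Preadditive.comp_add,
        Preadditive.add_comp, π_map, Functor.map_comp, Functor.map_comp, Functor.map_comp,
        ← Category.assoc (ξ.π X), ξ.π_map a, Category.assoc, Category.assoc, ξ.π_map b]
    have h₂ : stableRel B (ξ.map g + ξ.map a ≫ ξ.map b) (ξ.map g) :=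
      ⟨ξ.M P, ξ.projective_M hF P hP, _, _, add_sub_cancel_left _ _⟩
    exact Congruence.equivalence.trans h₁ h₂)

end StableChoice

end Functors

end StableFun

/-! For a projective `Q` of `B`, adjunction gives `Hom(F X, Q[i]) ≅ Hom(X, (G Q)[i])`. The complex
`G Q` has no cohomology in positive degrees: for `P` projective, `Hom(P, (G Q)[i]) ≅ Hom(F P,
Q[i])`, which vanishes for `i > 0` because `F P` is a complex of projectives in degrees `≥ 0`
(`isLE_rightAdjoint_obj`). Being also a bounded complex of projectives, `G Q` can be truncated to
one in degrees `≤ 0` (`projInterval_of_isLE`), and dévissage over its terms carries the vanishing of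
`Hom(X, P[i])` for `i > m` to `G Q` (`leftPerpGT_projInterval`). In the triangle `F X ⟶ M_X ⟶
U_X[1]`, the object `U_X[1]` lives in degrees `≥ 0`, so it has no maps to `Q[i]` for `i > 0`, and
the vanishing passes from `F X` to `M_X` (`StableChoice.leftPerpGT_M`).

For the second claim, Gorenstein projectivity is recast as membership in a sequence `(Z i)`, indexed
by `ℤ`, of objects with no positive extensions into projectives, consecutive ones being joined by
short exact sequences with projective middle term (`IsGorensteinProjective.exists_cosyzygies`,
`isGorensteinProjective_of_cosyzygies`). The extension condition survives `X ↦ M_X` by the first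
claim with `m = 0`; the short exact sequences survive by a horseshoe argument with octahedra
(`isCosyzygy_of_triangles`). -/

namespace StableFun

/-! ### Cycles in bounded above complexes of projectives. -/

section ComplexLemmas

variable {A : Type u} [Category.{v} A] [Abelian A]

lemma iCycles_toCycles (K : CochainComplex A ℤ) (i j : ℤ) :
    K.iCycles i ≫ K.toCycles i j = 0 := by
  rw [← cancel_mono (K.iCycles j), Category.assoc, K.toCycles_i, K.iCycles_d, zero_comp]

lemma shortExact_iCycles_toCycles (K : CochainComplex A ℤ) (i j : ℤ) (hij : i + 1 = j)
    (hK : K.ExactAt j) :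
    (ShortComplex.mk (K.iCycles i) (K.toCycles i j) (iCycles_toCycles K i j)).ShortExact where
  exact := ShortComplex.exact_of_f_is_kernel _ (Fork.IsLimit.mk' _ fun s => by
    refine ⟨K.liftCycles (Fork.ι s) j (by simp [← hij]) ?_, ?_, ?_⟩
    · have h : Fork.ι s ≫ K.toCycles i j = 0 := KernelFork.condition s
      rw [← K.toCycles_i i j, reassoc_of% h, zero_comp]
    · exact K.liftCycles_i _ _ _ _
    · intro m hm
      rw [← cancel_mono (K.iCycles i)]
      exact hm.trans (K.liftCycles_i _ _ _ _).symm)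
  mono_f := inferInstanceAs (Mono (K.iCycles i))
  epi_g := by
    rw [HomologicalComplex.exactAt_iff_isZero_homology] at hK
    exact Preadditive.epi_of_isZero_cokernel' _ (K.homologyIsCokernel i j (by simp [← hij])) hK

/-- Descending induction from degrees above `b`, where the cycles are zero: exactness above `n`
gives `0 ⟶ Zⁱ ⟶ Kⁱ ⟶ Zⁱ⁺¹ ⟶ 0`, which splits once `Zⁱ⁺¹` is projective. -/
lemma projective_cycles {K : CochainComplex A ℤ} {b n : ℤ} [K.IsStrictlyLE b] [K.IsLE n]
    (hK : ∀ i : ℤ, Projective (K.X i)) (i : ℤ) (hi : n ≤ i) : Projective (K.cycles i) := by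
  have hz (j : ℤ) (hj : b < j) : Projective (K.cycles j) :=
    Projective.of_iso (IsZero.isoZero
      ((K.isZero_of_isStrictlyLE b j hj).of_mono (K.iCycles j))).symm inferInstance
  obtain ⟨k, hk⟩ : ∃ k : ℕ, b < i + k := ⟨(b - i + 1).toNat, by lia⟩
  induction k generalizing i with
  | zero => exact hz i (by simpa using hk)
  | succ k ih =>
    have := ih (i + 1) (by lia) (by push_cast at hk; lia)
    have hS := shortExact_iCycles_toCycles K i (i + 1) rfl (K.exactAt_of_isLE n (i + 1))
    have := hK i
    have := hS.epi_g
    exact Retract.projective ⟨_, _, (ShortComplex.Splitting.ofExactOfSection _ hS.exact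
      (Projective.factorThru (𝟙 _) (K.toCycles i (i + 1)))
      (Projective.factorThru_comp _ _) hS.mono_f).f_r⟩

end ComplexLemmas

/-! ### Vanishing of morphisms, truncation and dévissage for complexes of projectives. -/

section DerivedCategoryLemmas

open DerivedCategory

variable {A : Type u} [Category.{v} A] [Abelian A] [HasDerivedCategory.{w} A]

/-- Such a morphism is represented by an actual chain map into a complex that is zero above `c`, so
in every degree its source or its target vanishes. -/
lemma eq_zero_of_projInterval_of_isLE {a b c : ℤ} {U T : DerivedCategory A}
    (hU : projInterval A a b U) (hT : T.IsLE c) (h : c < a) (f : U ⟶ T) : f = 0 := by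
  obtain ⟨K, h₁, h₂, h₃, ⟨e⟩⟩ := hU
  obtain ⟨L, hL, ⟨e'⟩⟩ := exists_iso_Q_obj_of_isLE T c
  obtain ⟨g, hg⟩ := Q_map_surjective K L b h₃ (e.inv ≫ f ≫ e'.hom)
  have : g = 0 := by
    ext i
    by_cases hi : i < a
    · exact (K.isZero_of_isStrictlyGE a i hi).eq_of_src _ _
    · exact (L.isZero_of_isStrictlyLE c i (by lia)).eq_of_tgt _ _
  rw [this, Functor.map_zero] at hg
  rw [← cancel_epi e.inv, ← cancel_mono e'.hom, Category.assoc, ← hg]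
  simp

/-- A projective `P` covering the cycles `Z⁰` defines a chain map `P ⟶ K`. It vanishes in the
derived category, hence on `H⁰`; but `P ⟶ Z⁰ ⟶ H⁰` is an epimorphism, so `H⁰ = 0`. -/
lemma exactAt_of_hom_eq_zero [EnoughProjectives A] (K : CochainComplex A ℤ)
    (h : ∀ P : A, Projective P → ∀ f : (singleFunctor A 0).obj P ⟶ Q.obj K, f = 0) :
    K.ExactAt 0 := by
  let P := Projective.over (K.cycles 0)
  let g : (HomologicalComplex.single A (.up ℤ) 0).obj P ⟶ K :=
    HomologicalComplex.mkHomFromSingle (Projective.π (K.cycles 0) ≫ K.iCycles 0) (by simp)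
  have hg : HomologicalComplex.homologyMap g 0 = 0 := by
    have h₁ := homologyFunctorFactors_hom_naturality g 0
    have h₂ : Q.map g = 0 := h _ inferInstance _
    rw [h₂, Functor.map_zero, zero_comp] at h₁
    exact (cancel_epi ((homologyFunctorFactors A 0).hom.app _)).1 (h₁.symm.trans comp_zero.symm)
  let s : P ⟶ ((HomologicalComplex.single A (.up ℤ) 0).obj P).cycles 0 :=
    HomologicalComplex.liftCycles _
      (HomologicalComplex.singleObjXSelf (.up ℤ) 0 P).inv 1 (by simp) (by
        exact (HomologicalComplex.isZero_single_obj_X (.up ℤ) 0 P 1 (by simp)).eq_of_tgt _ _)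
  have hs : s ≫ HomologicalComplex.cyclesMap g 0 = Projective.π (K.cycles 0) := by
    rw [← cancel_mono (K.iCycles 0), Category.assoc, HomologicalComplex.cyclesMap_i]
    simp only [s, g, HomologicalComplex.liftCycles_i_assoc]
    rw [HomologicalComplex.mkHomFromSingle_f, Iso.inv_hom_id_assoc]
  have hπ : Projective.π (K.cycles 0) ≫ K.homologyπ 0 = 0 := by
    rw [← hs, Category.assoc, ← HomologicalComplex.homologyπ_naturality, hg, comp_zero, comp_zero]
  rw [HomologicalComplex.exactAt_iff_isZero_homology, IsZero.iff_id_eq_zero,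
    ← cancel_epi (K.homologyπ 0), ← cancel_epi (Projective.π (K.cycles 0)),
    reassoc_of% hπ]
  simp

lemma isLE_of_hom_eq_zero [EnoughProjectives A] (T : DerivedCategory A) (n : ℤ)
    (h : ∀ P : A, Projective P → ∀ i : ℤ, n < i →
      ∀ f : (singleFunctor A 0).obj P ⟶ T⟦i⟧, f = 0) : T.IsLE n := by
  obtain ⟨K, ⟨e⟩⟩ : ∃ K, Nonempty (T ≅ Q.obj K) := ⟨_, ⟨(Q.objObjPreimageIso T).symm⟩⟩
  suffices K.IsLE n from ⟨(TStructure.t.le n).prop_of_iso e.symm (Triangulated.TStructure.le_of_isLE _ _ _)⟩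
  rw [CochainComplex.isLE_iff]
  intro i hi
  have : (K⟦i⟧).ExactAt 0 := exactAt_of_hom_eq_zero _ (fun P hP f => by
    rw [← cancel_mono ((Q.commShiftIso i).hom.app K), ← cancel_mono (e.inv⟦i⟧'), zero_comp,
      zero_comp]
    exact h P hP i hi _)
  rw [HomologicalComplex.exactAt_iff_isZero_homology] at this ⊢
  exact this.of_iso
    (((HomologicalComplex.homologyFunctor A (.up ℤ) 0).shiftIso i 0 i (by lia)).symm.app K)

/-- The canonical truncation keeps the terms below `n` and puts the cycles in degree `n`, which are
projective by `projective_cycles`. -/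
lemma projInterval_of_isLE {a b n : ℤ} {T : DerivedCategory A} (hT : projInterval A a b T)
    (h : T.IsLE n) : projInterval A a n T := by
  obtain ⟨K, h₁, h₂, h₃, ⟨e⟩⟩ := hT
  have : K.IsLE n := by
    rw [← isLE_Q_obj_iff]
    exact ⟨(TStructure.t.le n).prop_of_iso e (Triangulated.TStructure.le_of_isLE _ _ _)⟩
  refine ⟨K.truncLE n, inferInstance, inferInstance, fun i => ?_,
    ⟨e ≪≫ (asIso (Q.map (K.ιTruncLE n))).symm⟩⟩
  obtain hi | rfl | hi := lt_trichotomy i n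
  · exact Projective.of_iso (K.truncLEXIso n i hi).symm (h₃ i)
  · exact Projective.of_iso (K.truncLEXIsoCycles i).symm
      (projective_cycles (b := b) (n := i) h₃ i le_rfl)
  · exact Projective.of_iso
      (CochainComplex.isZero_of_isStrictlyLE (K.truncLE n) n i hi).isoZero.symm inferInstance

/-- Dévissage along the brutal filtration: each step splits off the lowest term `K.X a`, and `k`
bounds the number of terms. -/
lemma leftPerpGT_projInterval {m : ℤ} {Z : DerivedCategory A}
    (hZ : leftPerpGT m (projSingle A) Z) (k : ℕ) {a b : ℤ} (hab : b < a + k)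
    {T : DerivedCategory A}
    (hT : projInterval A a b T) {i : ℤ} (hi : m + b < i) (f : Z ⟶ T⟦i⟧) : f = 0 := by
  induction k generalizing a b T with
  | zero =>
    have hLE : T.IsLE b := by
      obtain ⟨K, h₁, h₂, h₃, ⟨e⟩⟩ := hT
      exact ⟨(TStructure.t.le b).prop_of_iso e.symm ⟨K, Iso.refl _, h₂⟩⟩
    have hT' : IsZero T := (IsZero.iff_id_eq_zero T).2
      (eq_zero_of_projInterval_of_isLE hT hLE (by simpa using hab) _)
    exact ((shiftFunctor _ i).map_isZero hT').eq_of_tgt _ _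
  | succ k ih =>
    obtain ⟨K, h₁, h₂, h₃, ⟨e⟩⟩ := hT
    -- Once `a ≤ b`, the bound `m + b < i` yields `m < i - a`, as needed for the term in degree `a`.
    by_cases hba : b < a
    · exact ih (by lia) ⟨K, h₁, h₂, h₃, ⟨e⟩⟩ hi f
    -- The projection onto the lowest term is a chain map since `K` vanishes in degree `a - 1`; its
    -- kernel is the part of `K` in degrees `> a`.
    let p : K ⟶ (HomologicalComplex.single A (.up ℤ) a).obj (K.X a) :=
      HomologicalComplex.mkHomToSingle (𝟙 _) (fun i hi =>
        (K.isZero_of_isStrictlyGE a i (by have : i + 1 = a := hi; lia)).eq_of_src _ _)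
    have hpa : IsIso (p.f a) := by
      dsimp only [p]
      rw [HomologicalComplex.mkHomToSingle_f]
      infer_instance
    have hz (j : ℤ) (hj : j ≠ a) :
        IsZero (((HomologicalComplex.single A (.up ℤ) a).obj (K.X a)).X j) :=
      HomologicalComplex.isZero_single_obj_X (.up ℤ) a (K.X a) j hj
    have hp (j : ℤ) : Epi (p.f j) := by
      by_cases hj : j = a
      · subst hj
        infer_instance
      · exact ⟨fun _ _ _ => (hz j hj).eq_of_src _ _⟩
    have : Epi p := HomologicalComplex.epi_of_epi_f _ hp
    have hS : (ShortComplex.mk (kernel.ι p) p (kernel.condition p)).ShortExact :=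
      { exact := ShortComplex.exact_kernel p }
    let eX (j : ℤ) : (kernel p).X j ≅ kernel (p.f j) :=
      PreservesKernel.iso (HomologicalComplex.eval _ _ j) p
    have hX (j : ℤ) (hj : j ≠ a) : Nonempty ((kernel p).X j ≅ K.X j) := by
      have hp₀ : p.f j = 0 := (hz j hj).eq_of_tgt _ _
      exact ⟨eX j ≪≫ kernelIsoOfEq hp₀ ≪≫ kernelZeroIsoSource⟩
    have hX' : IsZero ((kernel p).X a) := (isZero_kernel_of_mono (p.f a)).of_iso (eX a)
    have hker : projInterval A (a + 1) b (Q.obj (kernel p)) := by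
      refine ⟨kernel p, ?_, ?_, fun j => ?_, ⟨Iso.refl _⟩⟩
      · rw [CochainComplex.isStrictlyGE_iff]
        intro j hj
        by_cases hja : j = a
        · exact hja ▸ hX'
        · exact (K.isZero_of_isStrictlyGE a j (by lia)).of_iso (hX j hja).some
      · rw [CochainComplex.isStrictlyLE_iff]
        intro j hj
        exact (K.isZero_of_isStrictlyLE b j hj).of_iso (hX j (by lia)).some
      · by_cases hja : j = a
        · exact hja ▸ hX'.projective
        · exact Projective.of_iso (hX j hja).some.symm (h₃ j)
    have hsingle (g : Z ⟶ ((singleFunctor A a).obj (K.X a))⟦i⟧) : g = 0 := by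
      let e' : ((singleFunctor A a).obj (K.X a))⟦i⟧ ≅
          ((singleFunctor A 0).obj (K.X a))⟦-a + i⟧ :=
        (shiftFunctor _ i).mapIso (((singleFunctors A).shiftIso (-a) a 0 (by lia)).symm.app _) ≪≫
          ((shiftFunctorAdd _ (-a) i).symm.app _)
      rw [← cancel_mono e'.hom, zero_comp]
      exact hZ _ ⟨_, h₃ a, rfl⟩ _ (by lia) _
    have hT := Triangle.shift_distinguished _ (triangleOfSES_distinguished hS) i
    rw [← cancel_mono (e.hom⟦i⟧'), zero_comp]
    obtain ⟨g, hg⟩ := Triangle.coyoneda_exact₂ _ hT (f ≫ e.hom⟦i⟧') (hsingle _)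
    have hg₀ : g = 0 := ih (by push_cast at hab; lia) hker hi g
    exact hg.trans ((congr_arg (· ≫ _) hg₀).trans zero_comp)

end DerivedCategoryLemmas
end StableFun

namespace StableFun

/-! ### Gorenstein projectives as two-sided sequences of cosyzygies. -/

section GorensteinProjective

open DerivedCategory

variable {A : Type u} [Category.{v} A] [Abelian A]

/-- `X` and `Y` fit into a short exact sequence `0 ⟶ X ⟶ P ⟶ Y ⟶ 0` with `P` projective. -/
def IsCosyzygy (X Y : A) : Prop :=
  ∃ (P : A) (i : X ⟶ P) (p : P ⟶ Y) (h : i ≫ p = 0),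
    (ShortComplex.mk i p h).ShortExact ∧ Projective P

lemma IsCosyzygy.of_iso {X Y X' Y' : A} (h : IsCosyzygy X Y) (e : X ≅ X') (e' : Y ≅ Y') :
    IsCosyzygy X' Y' := by
  obtain ⟨P, i, p, w, hS, hP⟩ := h
  have w' : (e.inv ≫ i) ≫ p ≫ e'.hom = 0 := by simp [reassoc_of% w]
  exact ⟨P, e.inv ≫ i, p ≫ e'.hom, w', ShortComplex.shortExact_of_iso
    (ShortComplex.isoMk (S₁ := .mk i p w) (S₂ := .mk _ _ w') e (Iso.refl P) e' (by simp)
      (by simp)) hS, hP⟩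

variable [HasDerivedCategory.{w} A]

lemma leftPerpGT_of_iso {n : ℤ} {𝒳 : ObjectProperty (DerivedCategory A)} {Z Z' : DerivedCategory A}
    (h : leftPerpGT n 𝒳 Z) (e : Z ≅ Z') : leftPerpGT n 𝒳 Z' := fun X hX i hi f => by
  rw [← cancel_epi e.hom, comp_zero]
  exact h X hX i hi _

lemma projInterval_single {P : A} (hP : Projective P) :
    projInterval A 0 0 ((singleFunctor A 0).obj P) := by
  refine ⟨(CochainComplex.singleFunctor A 0).obj P, inferInstance, inferInstance, fun i => ?_,
    ⟨(singleFunctorIsoCompQ A 0).app P⟩⟩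
  by_cases hi : i = 0
  · subst hi
    exact Projective.of_iso (HomologicalComplex.singleObjXSelf (.up ℤ) 0 P).symm hP
  · exact (HomologicalComplex.isZero_single_obj_X (.up ℤ) 0 P i hi).projective

lemma isLE_single_shift (M : A) (n m : ℤ) (h : n + m = 0) :
    IsLE (((singleFunctor A 0).obj M)⟦n⟧) m :=
  Triangulated.TStructure.isLE_shift _ _ 0 n m h

/-- Dimension shifting along a short exact sequence with projective middle term. -/
lemma eq_zero_of_shortExact {S : ShortComplex A} (hS : S.ShortExact) (hP : Projective S.X₂)
    (Q : A) (n : ℕ)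
    (h : ∀ g : (singleFunctor A 0).obj S.X₁ ⟶ ((singleFunctor A 0).obj Q)⟦(n : ℤ)⟧,
      ∃ g', g = (singleFunctor A 0).map S.f ≫ g')
    (f : (singleFunctor A 0).obj S.X₃ ⟶ ((singleFunctor A 0).obj Q)⟦(n + 1 : ℤ)⟧) : f = 0 := by
  have h₂ : hS.singleTriangle.mor₂ ≫ f = 0 :=
    eq_zero_of_projInterval_of_isLE (projInterval_single hP)
      (isLE_single_shift Q (n + 1) (-(n + 1)) (by lia)) (by lia) _
  obtain ⟨g, hg⟩ : ∃ g : ((singleFunctor A 0).obj S.X₁)⟦(1 : ℤ)⟧ ⟶ _, f = hS.singleδ ≫ g :=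
    Triangle.yoneda_exact₃ _ hS.singleTriangle_distinguished f h₂
  let e := (shiftFunctorAdd (DerivedCategory A) (n : ℤ) 1).app ((singleFunctor A 0).obj Q)
  obtain ⟨k, hk⟩ := (shiftFunctor (DerivedCategory A) (1 : ℤ)).map_surjective (g ≫ e.hom)
  obtain ⟨k', hk'⟩ := h k
  have h₃ : hS.singleδ ≫ ((singleFunctor A 0).map S.f)⟦(1 : ℤ)⟧' = 0 :=
    comp_distTriang_mor_zero₃₁ _ hS.singleTriangle_distinguished
  rw [← cancel_mono e.hom, zero_comp, hg, Category.assoc, ← hk, hk', Functor.map_comp,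
    reassoc_of% h₃, zero_comp]

lemma exists_extension_of_shortExact {S : ShortComplex A} (hS : S.ShortExact) (Q : A)
    (h : ∀ f : (singleFunctor A 0).obj S.X₃ ⟶ ((singleFunctor A 0).obj Q)⟦(1 : ℤ)⟧, f = 0)
    (g : S.X₁ ⟶ Q) : ∃ g' : S.X₂ ⟶ Q, S.f ≫ g' = g := by
  have hT := rot_of_distTriang _ hS.singleTriangle_distinguished
  obtain ⟨k, hk⟩ : ∃ k : ((singleFunctor A 0).obj S.X₂)⟦(1 : ℤ)⟧ ⟶ _,
      ((singleFunctor A 0).map g)⟦(1 : ℤ)⟧' = (-((singleFunctor A 0).map S.f)⟦(1 : ℤ)⟧') ≫ k :=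
    Triangle.yoneda_exact₃ _ hT (((singleFunctor A 0).map g)⟦(1 : ℤ)⟧') (h _)
  obtain ⟨k, rfl⟩ := (shiftFunctor (DerivedCategory A) (1 : ℤ)).map_surjective k
  obtain ⟨k, rfl⟩ := (singleFunctor A 0).map_surjective k
  refine ⟨-k, (singleFunctor A 0).map_injective
    ((shiftFunctor (DerivedCategory A) (1 : ℤ)).map_injective ?_)⟩
  rw [hk]
  simp [Preadditive.comp_neg, Functor.map_neg, Functor.map_comp]

lemma leftPerpGT_cycles (K : CochainComplex A ℤ) (hK : ∀ i : ℤ, Projective (K.X i))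
    (hK' : K.Acyclic)
    (hK'' : ∀ (Q : A), Projective Q → ∀ (i : ℤ) (f : K.X i ⟶ Q), K.d (i - 1) i ≫ f = 0 →
      ∃ g : K.X (i + 1) ⟶ Q, K.d i (i + 1) ≫ g = f) (i : ℤ) :
    leftPerpGT 0 (projSingle A) ((singleFunctor A 0).obj (K.cycles i)) := by
  rintro _ ⟨Q, hQ, rfl⟩ j hj
  obtain ⟨n, rfl⟩ : ∃ n : ℕ, j = n + 1 := ⟨(j - 1).toNat, by lia⟩
  obtain ⟨i, rfl⟩ : ∃ k, i = k + 1 + 1 := ⟨i - 1 - 1, by lia⟩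
  have hS (i : ℤ) := shortExact_iCycles_toCycles K i (i + 1) rfl (hK' _)
  induction n generalizing i with
  | zero =>
    refine eq_zero_of_shortExact (hS (i + 1)) (hK _) Q 0 (fun g => ?_)
    let e := (shiftFunctorZero (DerivedCategory A) ℤ).app ((singleFunctor A 0).obj Q)
    obtain ⟨γ, hγ⟩ := (singleFunctor A 0).map_surjective (g ≫ e.hom)
    -- Exactness of `Hom(K, Q)` is exactly what extends `γ` from the cycles to `K.X (i + 1)`.
    obtain ⟨γ', hγ'⟩ := hK'' Q hQ i (K.toCycles i (i + 1) ≫ γ) (by simp)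
    have := (hS i).epi_g
    have h : K.iCycles (i + 1) ≫ γ' = γ := by
      rw [← cancel_epi (K.toCycles i (i + 1)), ← hγ', K.toCycles_i_assoc]
    refine ⟨(singleFunctor A 0).map γ' ≫ e.inv, ?_⟩
    rw [← cancel_mono e.hom, ← hγ, ← h, Functor.map_comp]
    simp
  | succ n ih =>
    refine eq_zero_of_shortExact (hS (i + 1)) (hK _) Q (n + 1) (fun g => ⟨0, ?_⟩)
    obtain ⟨i, rfl⟩ : ∃ k, i = k + 1 := ⟨i - 1, by lia⟩
    rw [comp_zero]
    exact ih (by lia) i g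

/-- The sequence consists of the cycles of the complex, with the one in degree `1` replaced by `X`.
The equality `Z 1 = X` must be literal: the triangles are chosen object by object, so isomorphic
objects may receive non-isomorphic `M`. -/
lemma IsGorensteinProjective.exists_cosyzygies {X : A} (hX : IsGorensteinProjective X) :
    ∃ Z : ℤ → A, Z 1 = X ∧ (∀ i, IsCosyzygy (Z i) (Z (i + 1))) ∧
      ∀ i, leftPerpGT 0 (projSingle A) ((singleFunctor A 0).obj (Z i)) := by
  obtain ⟨K, hK, hK', hK'', ⟨e⟩⟩ := hX
  have hS (i : ℤ) := shortExact_iCycles_toCycles K i (i + 1) rfl (hK' _)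
  have : Epi (K.toCycles 0 1) := (hS 0).epi_g
  have : StrongEpi (K.toCycles 0 1) := strongEpi_of_epi _
  let e₁ : K.cycles 1 ≅ X :=
    image.isoStrongEpiMono (K.toCycles 0 1) (K.iCycles 1) (K.toCycles_i 0 1) ≪≫ e.symm
  have hZ (i : ℤ) : Nonempty (K.cycles i ≅ Function.update (fun i => K.cycles i) 1 X i) := by
    by_cases hi : i = 1
    · subst hi
      exact ⟨e₁ ≪≫ eqToIso (by simp)⟩
    · exact ⟨eqToIso (by simp [hi])⟩
  refine ⟨Function.update (fun i => K.cycles i) 1 X, by simp, fun i => ?_, fun i => ?_⟩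
  · exact IsCosyzygy.of_iso ⟨_, _, _, _, hS i, hK i⟩ (hZ i).some (hZ (i + 1)).some
  · exact leftPerpGT_of_iso (leftPerpGT_cycles K hK hK' hK'' i)
      ((singleFunctor A 0).mapIso (hZ i).some)

/-- The short exact sequences are spliced into a complex whose differential factors through `Z (i +
1)`, so that its image in degree `1` is `Z 1`. -/
lemma isGorensteinProjective_of_cosyzygies (Z : ℤ → A) (hZ : ∀ i, IsCosyzygy (Z i) (Z (i + 1)))
    (hZ' : ∀ i, leftPerpGT 0 (projSingle A) ((singleFunctor A 0).obj (Z i))) :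
    IsGorensteinProjective (Z 1) := by
  choose P ι p w hS hP using hZ
  have hι (i : ℤ) : Mono (ι i) := (hS i).mono_f
  have hp (i : ℤ) : Epi (p i) := (hS i).epi_g
  let K : CochainComplex A ℤ := CochainComplex.of P (fun i => p i ≫ ι (i + 1))
    (fun i => by simp [reassoc_of% w])
  have hd (i : ℤ) : K.d i (i + 1) = p i ≫ ι (i + 1) := 
    CochainComplex.of_d P (fun i => p i ≫ ι (i + 1)) i
  refine ⟨K, hP, fun i => ?_, fun Q hQ i f hf => ?_, ⟨?_⟩⟩
  -- Precomposing with the epimorphism `p i` and postcomposing with a mono do not affect exactness,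
  -- so it reduces to that of the given sequence.
  · obtain ⟨i, rfl⟩ : ∃ k, i = k + 1 := ⟨i - 1, by lia⟩
    rw [K.exactAt_iff' i (i + 1) (i + 1 + 1) (by simp) (by simp)]
    let S : ShortComplex A := ShortComplex.mk (ι (i + 1)) (p (i + 1) ≫ ι (i + 1 + 1))
      (by simp [reassoc_of% w])
    let φ : K.sc' i (i + 1) (i + 1 + 1) ⟶ S :=
      { τ₁ := p i
        τ₂ := 𝟙 _
        τ₃ := 𝟙 _
        comm₁₂ := (hd i).symm.trans (Category.comp_id _).symm
        comm₂₃ := (Category.id_comp _).trans ((hd (i + 1)).symm.trans (Category.comp_id _).symm) }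
    let ψ : ShortComplex.mk (ι (i + 1)) (p (i + 1)) (w _) ⟶ S :=
      { τ₁ := 𝟙 _
        τ₂ := 𝟙 _
        τ₃ := ι _ }
    have : Epi φ.τ₁ := hp i
    have : IsIso φ.τ₂ := inferInstanceAs (IsIso (𝟙 (P (i + 1))))
    have : Mono φ.τ₃ := inferInstanceAs (Mono (𝟙 (P (i + 1 + 1))))
    have : Epi ψ.τ₁ := by dsimp [ψ]; infer_instance
    have : IsIso ψ.τ₂ := by dsimp [ψ]; infer_instance
    have : Mono ψ.τ₃ := hι _
    rw [ShortComplex.exact_iff_of_epi_of_isIso_of_mono φ,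
      ← ShortComplex.exact_iff_of_epi_of_isIso_of_mono ψ]
    exact (hS _).exact
  · obtain ⟨i, rfl⟩ : ∃ k, i = k + 1 := ⟨i - 1, by lia⟩
    rw [show i + 1 - 1 = i by lia, hd, Category.assoc] at hf
    have hf' : ι (i + 1) ≫ f = 0 := by rw [← cancel_epi (p i), hf, comp_zero]
    have := hp (i + 1)
    -- The map `f` descends to `Z (i + 1 + 1)`, and the result extends to the next projective
    -- because the first extension group of the following cosyzygy by `Q` vanishes.
    obtain ⟨g, hg⟩ := exists_extension_of_shortExact (hS (i + 1 + 1)) Q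
      (hZ' _ _ ⟨Q, hQ, rfl⟩ 1 (by lia)) ((hS (i + 1)).exact.desc f hf')
    refine ⟨g, ?_⟩
    rw [hd, Category.assoc]
    exact (congr_arg (p (i + 1) ≫ ·) hg).trans ((hS (i + 1)).exact.g_desc f hf')
  · have : StrongEpi (p 0) := strongEpi_of_epi _
    exact image.isoStrongEpiMono (I' := Z (0 + 1)) (Y := K.X (0 + 1)) (p 0) (ι (0 + 1)) (hd 0).symm

end GorensteinProjective

end StableFun

namespace StableFun

/-! ### From distinguished triangles to short exact sequences. -/

section Cosyzygy

open DerivedCategory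

variable {A : Type u} [Category.{v} A] [Abelian A] [HasDerivedCategory.{w} A]

lemma projective_of_projInterval {n : ℤ} {P : A}
    (h : projInterval A 0 n ((singleFunctor A 0).obj P)) : Projective P := by
  obtain ⟨R, hR, a, b, hab⟩ := exists_fac h (𝟙 _) (𝟙 _)
  exact Retract.projective ⟨a, b, (singleFunctor A 0).map_injective (by rw [← hab]; simp)⟩

lemma singleFunctor_shift_hom_eq_zero {M N : A}
    (f : ((singleFunctor A 0).obj M)⟦(1 : ℤ)⟧ ⟶ (singleFunctor A 0).obj N) : f = 0 :=
  have := isLE_single_shift M 1 (-1) (by lia)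
  TStructure.t.zero f (-1) 0 (by lia)

/-- Obstructions to left and right exactness are maps from a shifted object `M[1]` to an unshifted
one, and these vanish. -/
lemma shortExact_of_distTriang {S : ShortComplex A}
    {δ : (singleFunctor A 0).obj S.X₃ ⟶ ((singleFunctor A 0).obj S.X₁)⟦(1 : ℤ)⟧}
    (hT : Triangle.mk ((singleFunctor A 0).map S.f) ((singleFunctor A 0).map S.g) δ ∈
      distTriang (DerivedCategory A)) : S.ShortExact := by
  have hf : Mono S.f := Preadditive.mono_of_cancel_zero _ (fun {K} k hk => by
    have hk' : ((singleFunctor A 0).map k)⟦(1 : ℤ)⟧' ≫ ((singleFunctor A 0).map S.f)⟦(1 : ℤ)⟧' = 0 := by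
      rw [← Functor.map_comp, ← Functor.map_comp, hk, Functor.map_zero, Functor.map_zero]
    obtain ⟨l, hl⟩ : ∃ l, ((singleFunctor A 0).map k)⟦(1 : ℤ)⟧' = l ≫ δ :=
      Triangle.coyoneda_exact₁ _ hT _ hk'
    rw [singleFunctor_shift_hom_eq_zero l, zero_comp] at hl
    refine (singleFunctor A 0).map_injective
      ((shiftFunctor (DerivedCategory A) (1 : ℤ)).map_injective ?_)
    rw [hl, Functor.map_zero, Functor.map_zero])
  have hg : Epi S.g := Preadditive.epi_of_cancel_zero _ (fun {K} k hk => by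
    have hk' : (singleFunctor A 0).map S.g ≫ (singleFunctor A 0).map k = 0 := by
      rw [← Functor.map_comp, hk, Functor.map_zero]
    obtain ⟨l, hl⟩ : ∃ l, (singleFunctor A 0).map k = δ ≫ l :=
      Triangle.yoneda_exact₃ _ hT _ hk'
    rw [singleFunctor_shift_hom_eq_zero l, comp_zero] at hl
    exact (singleFunctor A 0).map_injective (hl.trans (Functor.map_zero _ _ _).symm))
  have key {K : A} (k : K ⟶ S.X₂) (hk : k ≫ S.g = 0) : ∃ l, l ≫ S.f = k := by
    have hk' : (singleFunctor A 0).map k ≫ (singleFunctor A 0).map S.g = 0 := by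
      rw [← Functor.map_comp, hk, Functor.map_zero]
    obtain ⟨l, hl⟩ : ∃ l : (singleFunctor A 0).obj K ⟶ (singleFunctor A 0).obj S.X₁,
        (singleFunctor A 0).map k = l ≫ (singleFunctor A 0).map S.f :=
      Triangle.coyoneda_exact₂ _ hT _ hk'
    obtain ⟨l, rfl⟩ := (singleFunctor A 0).map_surjective l
    exact ⟨l, (singleFunctor A 0).map_injective (by rw [Functor.map_comp, hl])⟩
  exact { exact := ShortComplex.exact_of_f_is_kernel _
            (KernelFork.IsLimit.ofι' _ _ fun k hk => ⟨_, (key k hk).choose_spec⟩) }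

/-- As an extension of `N` by `M`, `E` has cohomology only in degree `0`; an object of `A` lying in
`𝒫[0, n]` is projective, since its identity factors through a projective. -/
lemma isCosyzygy_of_distTriang {M N : A} {E : DerivedCategory A}
    {f : (singleFunctor A 0).obj M ⟶ E} {g : E ⟶ (singleFunctor A 0).obj N}
    {δ : (singleFunctor A 0).obj N ⟶ ((singleFunctor A 0).obj M)⟦(1 : ℤ)⟧}
    (hT : Triangle.mk f g δ ∈ distTriang (DerivedCategory A)) {n : ℤ}
    (hE : projInterval A 0 n E) : IsCosyzygy M N := by
  have : E.IsLE 0 := TStructure.t.isLE₂ _ hT 0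
    (inferInstanceAs (((singleFunctor A 0).obj M).IsLE 0))
    (inferInstanceAs (((singleFunctor A 0).obj N).IsLE 0))
  have : E.IsGE 0 := TStructure.t.isGE₂ _ hT 0
    (inferInstanceAs (((singleFunctor A 0).obj M).IsGE 0))
    (inferInstanceAs (((singleFunctor A 0).obj N).IsGE 0))
  obtain ⟨P, ⟨e⟩⟩ := exists_iso_singleFunctor_obj_of_isGE_of_isLE E 0
  obtain ⟨i, hi⟩ := (singleFunctor A 0).map_surjective (f ≫ e.hom)
  obtain ⟨p, hp⟩ := (singleFunctor A 0).map_surjective (e.inv ≫ g)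
  have hT' : Triangle.mk ((singleFunctor A 0).map i) ((singleFunctor A 0).map p) δ ∈
      distTriang (DerivedCategory A) :=
    isomorphic_distinguished _ hT _ (Triangle.isoMk _ _ (Iso.refl _) e.symm (Iso.refl _)
      (by
        change (singleFunctor A 0).map i ≫ e.inv = 𝟙 _ ≫ f
        rw [hi, Category.assoc, Iso.hom_inv_id, Category.comp_id, Category.id_comp])
      (by
        change (singleFunctor A 0).map p ≫ 𝟙 _ = e.inv ≫ g
        rw [hp, Category.comp_id])
      (by
        change δ ≫ (𝟙 ((singleFunctor A 0).obj M))⟦(1 : ℤ)⟧' = 𝟙 _ ≫ δ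
        rw [CategoryTheory.Functor.map_id, Category.comp_id, Category.id_comp]))
  have hw : i ≫ p = 0 := (singleFunctor A 0).map_injective (by
    rw [Functor.map_comp, Functor.map_zero]
    exact comp_distTriang_mor_zero₁₂ _ hT')
  exact ⟨P, i, p, hw, shortExact_of_distTriang (S := .mk i p hw) hT',
    projective_of_projInterval ((projInterval A 0 n).prop_of_iso e hE)⟩

/-- A horseshoe-type construction: the third terms `M` and `N` of two triangles over the ends of a
distinguished triangle with middle term in `𝒫[0, n]` are the ends of a short exact sequence
with projective middle term. -/
lemma isCosyzygy_of_triangles {X P Y U V : DerivedCategory A} {M N : A} {n : ℤ}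
    {a : X ⟶ P} {b : P ⟶ Y} {h : Y ⟶ X⟦(1 : ℤ)⟧}
    (hT : Triangle.mk a b h ∈ distTriang (DerivedCategory A))
    {ι : U ⟶ X} {π : X ⟶ (singleFunctor A 0).obj M} {μ : (singleFunctor A 0).obj M ⟶ U⟦(1 : ℤ)⟧}
    (hX : Triangle.mk ι π μ ∈ distTriang (DerivedCategory A))
    {ι' : V ⟶ Y} {π' : Y ⟶ (singleFunctor A 0).obj N}
    {μ' : (singleFunctor A 0).obj N ⟶ V⟦(1 : ℤ)⟧}
    (hY : Triangle.mk ι' π' μ' ∈ distTriang (DerivedCategory A))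
    (hP : projInterval A 0 n P) (hU : projInterval A 1 n U) (hV : projInterval A 1 n V) :
    IsCosyzygy M N := by
  have hshift {Z : DerivedCategory A} (hZ : projInterval A 1 n Z) :
      projInterval A (-1) (n - 1) (Z⟦(1 : ℤ)⟧⟦(1 : ℤ)⟧) :=
    projInterval_mono (by lia) _ (projInterval_shift (projInterval_shift hZ 1 0 (n - 1)
      (by lia) (by lia)) 1 (-1) (n - 1 - 1) (by lia) (by lia))
  -- Four rotations make `-π[1]` the first morphism, with cone `U[2]`; this is where the sign below
  -- comes from.
  have hX' := rot_of_distTriang _ (rot_of_distTriang _ (rot_of_distTriang _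
    (rot_of_distTriang _ hX)))
  have hT' := rot_of_distTriang _ (rot_of_distTriang _ hT)
  have hY' := rot_of_distTriang _ hY
  -- The composite `Y ⟶ X[1] ⟶ M[1]` vanishes on `V`, which lives in degrees `≥ 1`, so it descends
  -- to a class `δ` extending `N` by `M`.
  obtain ⟨δ, hδ⟩ : ∃ δ : (singleFunctor A 0).obj N ⟶ ((singleFunctor A 0).obj M)⟦(1 : ℤ)⟧,
      h ≫ (-π⟦(1 : ℤ)⟧') = π' ≫ δ :=
    Triangle.yoneda_exact₂ _ hY (h ≫ (-π⟦(1 : ℤ)⟧'))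
      (eq_zero_of_projInterval_of_isLE hV (isLE_single_shift M 1 (-1) (by lia)) (by lia) _)
  obtain ⟨E, f, g, hE⟩ := distinguished_cocone_triangle₂ δ
  have hE' := rot_of_distTriang _ (rot_of_distTriang _ hE)
  obtain ⟨W, r, s, hW⟩ := distinguished_cocone_triangle (h ≫ (-π⟦(1 : ℤ)⟧'))
  -- The same composite is factored in two ways: `o₁` exhibits its cone `W` as an extension of
  -- `U[2]` by `P[1]`, and `o₂`, rotated, exhibits `E[1]` as an extension of `V[2]` by `W`.
  have o₁ := Triangulated.someOctahedron rfl hT' hX' hW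
  have o₂ := Triangulated.someOctahedron hδ.symm hY' hE' hW
  have hW' : projInterval A (-1) (n - 1) W := projInterval_ext _ _ _ ⟨_, _, _, _, _, o₁.mem,
    projInterval_shift hP 1 (-1) (n - 1) (by lia) (by lia), hshift hU⟩
  have hE₁ : projInterval A (-1) (n - 1) (E⟦(1 : ℤ)⟧) := projInterval_ext _ _ _
    ⟨_, _, _, _, _, rot_of_distTriang _ o₂.mem, hW', hshift hV⟩
  exact isCosyzygy_of_distTriang hE
    ((projInterval A 0 n).prop_of_iso ((shiftFunctorCompIsoId _ (1 : ℤ) (-1) (by simp)).app E)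
      (projInterval_shift hE₁ (-1) 0 n (by lia) (by lia)))

/-- A short exact sequence in `A` gives a distinguished triangle in `D^b(A)`. -/
lemma exists_single_distTriang {S : ShortComplex A} (hS : S.ShortExact) :
    ∃ δ : (single A).obj S.X₃ ⟶ ((single A).obj S.X₁)⟦(1 : ℤ)⟧,
      Triangle.mk ((single A).map S.f) ((single A).map S.g) δ ∈
        distTriang (DerivedCategory.Bounded A) := by
  let c : (((single A).obj S.X₁)⟦(1 : ℤ)⟧).obj ≅ ((singleFunctor A 0).obj S.X₁)⟦(1 : ℤ)⟧ :=
    ((Bounded.ι (C := A)).commShiftIso (1 : ℤ)).app ((single A).obj S.X₁)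
  refine ⟨ObjectProperty.homMk (hS.singleδ ≫ c.inv), ?_⟩
  rw [← (Bounded.ι (C := A)).map_distinguished_iff]
  refine isomorphic_distinguished _ hS.singleTriangle_distinguished _
    (Triangle.isoMk _ _ (Iso.refl _) (Iso.refl _) (Iso.refl _) ?_ ?_ ?_)
  · exact (Category.comp_id _).trans (Category.id_comp _).symm
  · exact (Category.comp_id _).trans (Category.id_comp _).symm
  · change ((hS.singleδ ≫ c.inv) ≫ c.hom) ≫ (𝟙 ((singleFunctor A 0).obj S.X₁))⟦(1 : ℤ)⟧' =
      𝟙 _ ≫ hS.singleδ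
    rw [CategoryTheory.Functor.map_id, Category.comp_id, Category.id_comp, Category.assoc, Iso.inv_hom_id,
      Category.comp_id]

end Cosyzygy

/-! ### The stable functor: preservation of cosyzygies and of orthogonality. -/

section Functors

open DerivedCategory

variable {A : Type u₁} [Category.{v₁} A] [Abelian A] [HasDerivedCategory.{w₁} A]
  {B : Type u₂} [Category.{v₂} B] [Abelian B] [HasDerivedCategory.{w₂} B]
  {F : DerivedCategory.Bounded A ⥤ DerivedCategory.Bounded B}

lemma StableChoice.isCosyzygy_M [F.CommShift ℤ] [F.IsTriangulated] (hF : IsNonnegative F)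
    (ξ : StableChoice F) {X Y : A} (h : IsCosyzygy X Y) : IsCosyzygy (ξ.M X) (ξ.M Y) := by
  obtain ⟨P, i, p, w, hS, hP⟩ := h
  obtain ⟨δ, hδ⟩ := exists_single_distTriang hS
  obtain ⟨n₀, hn₀⟩ := hF.proj P hP
  obtain ⟨n₁, -, hn₁⟩ := ξ.U_mem X
  obtain ⟨n₂, -, hn₂⟩ := ξ.U_mem Y
  let n := max n₀ (max n₁ n₂)
  exact isCosyzygy_of_triangles (n := n)
    ((Bounded.ι (C := B)).map_distinguished _ (F.map_distinguished _ hδ))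
    ((Bounded.ι (C := B)).map_distinguished _ (ξ.distinguished X))
    ((Bounded.ι (C := B)).map_distinguished _ (ξ.distinguished Y))
    (projInterval_mono (by lia) _ hn₀) (projInterval_mono (by lia) _ hn₁)
    (projInterval_mono (by lia) _ hn₂)

lemma Bounded.forall_hom_eq_zero_iff (X Y : DerivedCategory.Bounded A) (i : ℤ) :
    (∀ f : X.obj ⟶ Y.obj⟦i⟧, f = 0) ↔ ∀ f : X ⟶ Y⟦i⟧, f = 0 := by
  let e : (X ⟶ Y⟦i⟧) ≃ (X.obj ⟶ Y.obj⟦i⟧) :=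
    (Functor.FullyFaithful.ofFullyFaithful (Bounded.ι (C := A))).homEquiv.trans
      (((Bounded.ι (C := A)).commShiftIso i).app Y).homToEquiv
  rw [← subsingleton_iff_forall_eq, ← subsingleton_iff_forall_eq, e.subsingleton_congr]

/-- The right adjoint of a functor commuting with shifts inherits such a structure, so the
adjunction bijection is available in every degree. -/
lemma forall_hom_eq_zero_iff_of_adjunction [F.CommShift ℤ]
    {G : DerivedCategory.Bounded B ⥤ DerivedCategory.Bounded A} (adj : F ⊣ G)
    (X : DerivedCategory.Bounded A) (Y : DerivedCategory.Bounded B) (i : ℤ) :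
    (∀ f : (F.obj X).obj ⟶ Y.obj⟦i⟧, f = 0) ↔ ∀ f : X.obj ⟶ (G.obj Y).obj⟦i⟧, f = 0 := by
  let := adj.rightAdjointCommShift ℤ
  let e : (F.obj X ⟶ Y⟦i⟧) ≃ (X ⟶ (G.obj Y)⟦i⟧) :=
    (adj.homEquiv X (Y⟦i⟧)).trans ((G.commShiftIso i).app Y).homToEquiv
  rw [Bounded.forall_hom_eq_zero_iff, Bounded.forall_hom_eq_zero_iff,
    ← subsingleton_iff_forall_eq, ← subsingleton_iff_forall_eq, e.subsingleton_congr]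

lemma isLE_rightAdjoint_obj [EnoughProjectives A] [F.CommShift ℤ] (hF : IsNonnegative F)
    {G : DerivedCategory.Bounded B ⥤ DerivedCategory.Bounded A} (adj : F ⊣ G) (N : B) :
    IsLE (G.obj ((single B).obj N)).obj 0 := by
  refine isLE_of_hom_eq_zero _ 0 (fun P hP i hi =>
    (forall_hom_eq_zero_iff_of_adjunction adj ((single A).obj P) ((single B).obj N) i).1
      (fun f => ?_))
  obtain ⟨n, hn⟩ := hF.proj P hP
  exact eq_zero_of_projInterval_of_isLE hn (isLE_single_shift N i (-i) (by lia)) (by lia) f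

lemma StableChoice.leftPerpGT_M [EnoughProjectives A] [F.CommShift ℤ] (hF : IsNonnegative F)
    {G : DerivedCategory.Bounded B ⥤ DerivedCategory.Bounded A} (adj : F ⊣ G)
    (hG : ∀ Q : B, Projective Q → boundedProj A (G.obj ((single B).obj Q)).obj)
    (ξ : StableChoice F) {m : ℤ} (hm : 0 ≤ m) {X : A}
    (hX : leftPerpGT m (projSingle A) ((singleFunctor A 0).obj X)) :
    leftPerpGT m (projSingle B) ((singleFunctor B 0).obj (ξ.M X)) := by
  rintro _ ⟨Q, hQ, rfl⟩ i hi f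
  obtain ⟨a, b, hab⟩ := hG Q hQ
  have hGQ := projInterval_of_isLE hab (isLE_rightAdjoint_obj hF adj Q)
  have hFX := (forall_hom_eq_zero_iff_of_adjunction adj ((single A).obj X) ((single B).obj Q) i).2
    -- The length `1 - a` counts the degrees from `a` to `0`; the top degree being `0` is what keeps
    -- the bound `m` unchanged.
    (leftPerpGT_projInterval hX (1 - a).toNat (by lia) hGQ (by lia))
  obtain ⟨n, -, hn⟩ := ξ.U_mem X
  have hT := (Bounded.ι (C := B)).map_distinguished _ (ξ.distinguished X)
  obtain ⟨g, hg⟩ := Triangle.yoneda_exact₃ _ hT f (hFX _)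
  have hg₀ : g = 0 := eq_zero_of_projInterval_of_isLE
    (projInterval_shift hn 1 0 (n - 1) (by lia) (by lia))
    (isLE_single_shift Q i (-i) (by lia)) (by lia) g
  exact hg.trans ((congr_arg _ hg₀).trans comp_zero)

end Functors

end StableFun

theorem mainTheorem7
    {A : Type u₁} [Category.{v₁} A] [Abelian A] [EnoughProjectives A] [HasDerivedCategory.{w₁} A]
    {B : Type u₂} [Category.{v₂} B] [Abelian B] [EnoughProjectives B] [HasDerivedCategory.{w₂} B]
    (F : DerivedCategory.Bounded A ⥤ DerivedCategory.Bounded B)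
    [F.CommShift ℤ] [F.IsTriangulated] (hF : StableFun.IsNonnegative F)
    (G : DerivedCategory.Bounded B ⥤ DerivedCategory.Bounded A) (adj : F ⊣ G)
    (hG : ∀ Q : B, Projective Q →
      StableFun.boundedProj A (G.obj ((StableFun.single B).obj Q)).obj)
    (ξ : StableFun.StableChoice F) (m : ℕ) :
    (∀ X : StableFun.StableCat A,
      StableFun.leftPerpGT (m : ℤ) (StableFun.projSingle A)
        ((DerivedCategory.singleFunctor A 0).obj X.as) →
      StableFun.leftPerpGT (m : ℤ) (StableFun.projSingle B)
        ((DerivedCategory.singleFunctor B 0).obj ((ξ.stableFunctor hF).obj X).as)) ∧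
    (∀ X : StableFun.StableCat A,
      StableFun.IsGorensteinProjective X.as →
      StableFun.IsGorensteinProjective ((ξ.stableFunctor hF).obj X).as) := by
  refine ⟨fun X hX => ξ.leftPerpGT_M hF adj hG m.cast_nonneg hX, fun X hX => ?_⟩
  obtain ⟨Z, hZ, hZ', hZ''⟩ := hX.exists_cosyzygies
  have h := StableFun.isGorensteinProjective_of_cosyzygies (fun i => ξ.M (Z i))
    (fun i => ξ.isCosyzygy_M hF (hZ' i)) (fun i => ξ.leftPerpGT_M hF adj hG le_rfl (hZ'' i))
  rw [hZ] at h
  exact h
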